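/- Let $\mathbb R^3_1$ be $\mathbb R^3$ with the Lorentzian metric $\langle a,b\rangle=-a_1b_1+a_2b_2+a_3b_3$ and the Lorentzian cross product $a\boxtimes b=(a_3b_2-a_2b_3,\,a_3b_1-a_1b_3,\,a_1b_2-a_2b_1)$. Let $\mathbb H^2=\{x\in\mathbb R^3_1 : \langle x,x\rangle=-1,\ x_1>0\}$ be the hyperbolic plane of curvature $-1$, with complex structure $(J_{\mathbb H^2})_xv=x\boxtimes v$ and Kähler form $(\omega_{\mathbb H^2})_x(v,w)=\langle (J_{\mathbb H^2})_xv,w\rangle$. Equip $\mathbb H^2\times\mathbb H^2\subset\mathbb R^3_1\times\mathbb R^3_1$ with the product metric, also denoted $\langle\cdot,\cdot\rangle$, and with the complex structure $J=(J_{\mathbb H^2},-J_{\mathbb H^2})$. Let $\Sigma$ be a smooth surface and let $\Phi=(\phi_1,\phi_2):\Sigma\to\mathbb H^2\times\mathbb H^2$ be a smooth Lagrangian immersion, that is, an immersion such that $J$ maps every tangent plane $\Phi_*(T_p\Sigma)$ to its orthogonal complement. Equip $\Sigma$ with the induced metric. Let $h$ be the second fundamental form of $\Phi$, with squared norm $\|h\|^2=\sum_{i,j=1}^2\|h(e_i,e_j)\|^2$,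 and let $H=\tfrac12\left(h(e_1,e_1)+h(e_2,e_2)\right)$ be the mean curvature vector, where $(e_1,e_2)$ is any orthonormal basis of $T_p\Sigma$. Let $K$ be the Gaussian curvature of $\Sigma$. Let $\omega_\Sigma$ be a volume form compatible with the induced metric, on $\Sigma$ or on a part $U$ of $\Sigma$ (if $\Sigma$ is not orientable, such a form can only be chosen locally). Then there exists a function $\Gamma$ such that, at the points where $\omega_\Sigma$ is given, $$\phi_1^*\omega_{\mathbb H^2}=\phi_2^*\omega_{\mathbb H^2}=\Gamma\,\omega_\Sigma ,$$ and for every such function $\Gamma$, at all these points, $$K = 2\|H\|^2-\tfrac12\|h\|^2-2\Gamma^2 .$$ -/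

import Mathlib

open scoped Manifold ContDiff

noncomputable section

namespace LagrangianHH

/-- The underlying space of Minkowski three-space `ℝ³₁`. -/
abbrev R31 : Type := Fin 3 → ℝ

/-- The underlying space of `ℝ⁶₂ = ℝ³₁ × ℝ³₁`. -/
abbrev R62 : Type := R31 × R31

/-- The coordinate plane, model space of surfaces. -/
abbrev Plane : Type := EuclideanSpace ℝ (Fin 2)

/-- The Lorentzian metric of `ℝ³₁`. -/
def mink (a b : R31) : ℝ := -(a 0 * b 0) + a 1 * b 1 + a 2 * b 2

/-- The Lorentzian cross product of `ℝ³₁`. -/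
def cross (a b : R31) : R31 :=
  ![a 2 * b 1 - a 1 * b 2, a 2 * b 0 - a 0 * b 2, a 0 * b 1 - a 1 * b 0]

/-- The hyperbolic plane `H² = H²(-1)` of curvature `-1`, in the hyperboloid model. -/
def H2 : Set R31 := {x | mink x x = -1 ∧ 0 < x 0}

/-- The product `H² × H²`. -/
def HH : Set R62 := H2 ×ˢ H2

/-- The metric of `ℝ⁶₂`; on vectors tangent to `H² × H²` it is the Riemannian product metric. -/
def metric (v w : R62) : ℝ := mink v.1 w.1 + mink v.2 w.2

/-- The complex structure `J_x v = x ⊠ v` of `H²`. -/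
def JH2 (x v : R31) : R31 := cross x v

/-- The Kähler form `ω_x(v, w) = ⟨J_x v, w⟩` of `H²`. -/
def omegaH2 (x v w : R31) : ℝ := mink (JH2 x v) w

/-- The complex structure `J = (J_{H²}, -J_{H²})` of `H² × H²`. -/
def J (x v : R62) : R62 := (JH2 x.1 v.1, -JH2 x.2 v.2)

/-- Orthogonal projection of `ℝ⁶₂` onto the tangent space of `H² × H²` at `x`, which consists of the
`v` with `⟨v₁, x₁⟩ = ⟨v₂, x₂⟩ = 0` (recall `⟨xⱼ, xⱼ⟩ = -1`). -/
def projHH (x v : R62) : R62 :=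
  (v.1 + mink v.1 x.1 • x.1, v.2 + mink v.2 x.2 • x.2)

/-! ### Gaussian curvature of a metric given in coordinates on (an open part of) the plane -/

/-- The coordinate vectors of the plane. -/
def basisVec (i : Fin 2) : Plane := EuclideanSpace.single i 1

/-- The partial derivative `∂ᵢ u`. -/
def partialDeriv (i : Fin 2) (u : Plane → ℝ) (y : Plane) : ℝ := fderiv ℝ u y (basisVec i)

/-- The Christoffel symbol `Γᵏᵢⱼ = ½ ∑ₗ gᵏˡ (∂ᵢ gⱼₗ + ∂ⱼ gᵢₗ - ∂ₗ gᵢⱼ)` of the metric `g`. -/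
def christoffel (g : Plane → Matrix (Fin 2) (Fin 2) ℝ) (k i j : Fin 2) (y : Plane) : ℝ :=
  (1 / 2) * ∑ l, (g y)⁻¹ k l *
    (partialDeriv i (fun z => g z j l) y + partialDeriv j (fun z => g z i l) y
      - partialDeriv l (fun z => g z i j) y)

/-- The component `l` of `R(∂ᵢ, ∂ⱼ) ∂ₖ`, where `R(X, Y) = ∇_X ∇_Y - ∇_Y ∇_X - ∇_[X, Y]` is the
curvature tensor of the Levi-Civita connection of the metric `g`. -/
def riemannCoeff (g : Plane → Matrix (Fin 2) (Fin 2) ℝ) (l i j k : Fin 2) (y : Plane) : ℝ :=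
  partialDeriv i (christoffel g l j k) y - partialDeriv j (christoffel g l i k) y
    + ∑ m, (christoffel g l i m y * christoffel g m j k y
      - christoffel g l j m y * christoffel g m i k y)

/-- The Gaussian curvature `⟨R(∂₀, ∂₁) ∂₁, ∂₀⟩ / det g` of the metric `g` on the plane. -/
def gaussCurvatureCoord (g : Plane → Matrix (Fin 2) (Fin 2) ℝ) (y : Plane) : ℝ :=
  (∑ l, riemannCoeff g l 0 1 1 y * g y l 0) / (g y).det

/-! ### Surfaces in `H² × H²` -/

section Surface

variable {M : Type*} [TopologicalSpace M] [ChartedSpace Plane M]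

/-- The differential `Φ_* v`. -/
def push (Φ : M → R62) (p : M) (v : TangentSpace (𝓡 2) p) : R62 :=
  mfderiv (𝓡 2) 𝓘(ℝ, R62) Φ p v

/-- The pullback `φ^* ω_{H²}` of the Kähler form under `φ : M → H² ⊆ ℝ³₁`. -/
def pullbackOmega (φ : M → R31) (p : M) (v w : TangentSpace (𝓡 2) p) : ℝ :=
  omegaH2 (φ p) (mfderiv (𝓡 2) 𝓘(ℝ, R31) φ p v) (mfderiv (𝓡 2) 𝓘(ℝ, R31) φ p w)

/-- `Φ` is a (smooth) Lagrangian immersion into `H² × H²`: its differentials are injective, and `J`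
maps every tangent plane of the surface to its orthogonal complement. -/
structure IsLagrangianImmersion (Φ : M → R62) : Prop where
  smooth : ContMDiff (𝓡 2) 𝓘(ℝ, R62) ∞ Φ
  mem_HH : ∀ p, Φ p ∈ HH
  immersion : ∀ p, Function.Injective (mfderiv (𝓡 2) 𝓘(ℝ, R62) Φ p)
  lagrangian : ∀ (p : M) (v w : TangentSpace (𝓡 2) p),
    metric (J (Φ p) (push Φ p v)) (push Φ p w) = 0

/-- The induced metric (first fundamental form) on the tangent plane at `p`. -/
def inducedMetric (Φ : M → R62) (p : M) (v w : TangentSpace (𝓡 2) p) : ℝ :=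
  metric (push Φ p v) (push Φ p w)

/-- The coordinate expression of `Φ` in the preferred chart at `p`; this is the chart through which
the tangent space at `p` is identified with the plane. -/
def localRep (Φ : M → R62) (p : M) : Plane → R62 :=
  fun y => Φ ((extChartAt (𝓡 2) p).symm y)

/-- The matrix of the induced metric in the preferred chart at `p`. -/
def metricCoord (Φ : M → R62) (p : M) (y : Plane) : Matrix (Fin 2) (Fin 2) ℝ :=
  Matrix.of fun i j =>
    metric (fderiv ℝ (localRep Φ p) y (basisVec i)) (fderiv ℝ (localRep Φ p) y (basisVec j))

/-- The Gaussian curvature `K` of the surface, that is, of the induced metric. -/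
def gaussCurvature (Φ : M → R62) (p : M) : ℝ :=
  gaussCurvatureCoord (metricCoord Φ p) (extChartAt (𝓡 2) p p)

/-- The coordinate basis vectors of the tangent plane at `p`. -/
def tangentBasis (p : M) (i : Fin 2) : TangentSpace (𝓡 2) p := basisVec i

/-- The Gram matrix of the coordinate basis of the tangent plane at `p`. -/
def gram (Φ : M → R62) (p : M) : Matrix (Fin 2) (Fin 2) ℝ :=
  Matrix.of fun i j => inducedMetric Φ p (tangentBasis p i) (tangentBasis p j)

/-- The orthogonal projection of `v` onto the tangent plane `Φ_*(T_pM)` of the surface. -/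
def tangentPart (Φ : M → R62) (p : M) (v : R62) : R62 :=
  ∑ i, ∑ j, ((gram Φ p)⁻¹ i j * metric v (push Φ p (tangentBasis p j))) •
    push Φ p (tangentBasis p i)

/-- The Levi-Civita covariant derivative, in `H² × H²`, of the vector field `Φ_* W` along `Φ` in the
direction `v` at `p`, where `W` is the extension of `w` with constant components in the preferred
chart at `p`: the flat derivative in `ℝ⁶₂`, projected to the tangent space of `H² × H²`. -/
def ambientDeriv (Φ : M → R62) (p : M) (v w : TangentSpace (𝓡 2) p) : R62 :=
  projHH (Φ p) (fderiv ℝ (fun y : Plane => fderiv ℝ (localRep Φ p) y (w : Plane))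
    (extChartAt (𝓡 2) p p) (v : Plane))

/-- The second fundamental form `h` of `Φ`, as a surface in `H² × H²`: the component of the
covariant derivative of `H² × H²` that is normal to the surface. -/
def secondFundForm (Φ : M → R62) (p : M) (v w : TangentSpace (𝓡 2) p) : R62 :=
  ambientDeriv Φ p v w - tangentPart Φ p (ambientDeriv Φ p v w)

/-- The mean curvature vector `H = ½ tr h`, with the trace taken in the induced metric. -/
def meanCurvature (Φ : M → R62) (p : M) : R62 :=
  (1 / 2 : ℝ) • ∑ i, ∑ j,
    (gram Φ p)⁻¹ i j • secondFundForm Φ p (tangentBasis p i) (tangentBasis p j)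

/-- The squared norm of a vector tangent to `H² × H²`. -/
def normSq (v : R62) : ℝ := metric v v

/-- The squared norm `‖h‖² = ∑ gⁱᵏ gʲˡ ⟨hᵢⱼ, hₖₗ⟩` of the second fundamental form. -/
def secondFundFormNormSq (Φ : M → R62) (p : M) : ℝ :=
  ∑ i, ∑ j, ∑ k, ∑ l, (gram Φ p)⁻¹ i k * (gram Φ p)⁻¹ j l *
    metric (secondFundForm Φ p (tangentBasis p i) (tangentBasis p j))
      (secondFundForm Φ p (tangentBasis p k) (tangentBasis p l))

/-- On `U`, the two-form `vol` is a volume form compatible with the induced metric: it takes the values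
`±1` on orthonormal bases. Neither continuity of `vol` nor openness of `U` is asked for; the local
(smooth) volume forms on open sets are special cases. -/
def IsVolumeFormOn (Φ : M → R62) (vol : ∀ p : M, TangentSpace (𝓡 2) p [⋀^Fin 2]→ₗ[ℝ] ℝ)
    (U : Set M) : Prop :=
  ∀ p ∈ U, ∀ e₁ e₂ : TangentSpace (𝓡 2) p,
    inducedMetric Φ p e₁ e₁ = 1 → inducedMetric Φ p e₂ e₂ = 1 → inducedMetric Φ p e₁ e₂ = 0 →
      |vol p ![e₁, e₂]| = 1

/-- The defining property `φ₁^* ω_{H²} = φ₂^* ω_{H²} = Γ vol` of the function `Γ` on `U`, where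
`Φ = (φ₁, φ₂)`. -/
def IsGammaOn (Φ : M → R62) (vol : ∀ p : M, TangentSpace (𝓡 2) p [⋀^Fin 2]→ₗ[ℝ] ℝ)
    (U : Set M) (Γ : M → ℝ) : Prop :=
  ∀ p ∈ U, ∀ v w : TangentSpace (𝓡 2) p,
    pullbackOmega (fun q => (Φ q).1) p v w = Γ p * vol p ![v, w] ∧
    pullbackOmega (fun q => (Φ q).2) p v w = Γ p * vol p ![v, w]

end Surface

end LagrangianHH

end

open LagrangianHH

namespace LagrangianHH

/-! The proof is the Gauss equation, computed in a chart with `F` the coordinate expression of `Φ`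
in the flat space `ℝ⁶₂`. The Christoffel symbols of the induced metric are the tangential components
of `∂ᵢ∂ⱼF` (`christoffel_gramOf`). Hence `K · det g` is `⟨∂₁∂₁F, ∂₀∂₀F⟩ - ⟨∂₀∂₁F, ∂₀∂₁F⟩` minus the
same expression in the tangential parts (`riemannCoeff_gramOf`).

The rest of `∂ᵢ∂ⱼF` consists of `hᵢⱼ` and components along the two position vectors. Since `⟨F_a,
F_a⟩ = -1`, the latter are given by the first fundamental forms of the factors (`mink_pd_pd_self`).
They contribute minus the two Gram determinants, which are the squares of `φ_a^* ω(∂₀, ∂₁)`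
(`omegaH2_sq`). The `h` terms, divided by `det g`, are `2‖H‖² - ½‖h‖²` (`trace_sub_norm`).

The Lagrangian condition serves only to equate the two pullbacks (`pullbackOmega_snd_eq_fst`). As
`vol(∂₀, ∂₁)² = det g` (`vol_sq`), each square divided by `det g` is `Γ²`. -/

/-- The symmetric bilinear form `mink` as a continuous bilinear map. -/
noncomputable def minkL : R31 →L[ℝ] R31 →L[ℝ] ℝ :=
  (LinearMap.mk₂ ℝ mink
    (fun a b c => by simp only [mink, Pi.add_apply]; ring)
    (fun r a b => by simp only [mink, Pi.smul_apply, smul_eq_mul]; ring)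
    (fun a b c => by simp only [mink, Pi.add_apply]; ring)
    (fun r a b => by simp only [mink, Pi.smul_apply, smul_eq_mul]; ring)).toContinuousBilinearMap

theorem minkL_apply (a b : R31) : minkL a b = mink a b := rfl

theorem mink_add_left (a b c : R31) : mink (a + b) c = mink a c + mink b c := by
  simp only [mink, Pi.add_apply]; ring

theorem mink_smul_left (r : ℝ) (a b : R31) : mink (r • a) b = r * mink a b := by
  simp only [mink, Pi.smul_apply, smul_eq_mul]; ring

theorem mink_comm (a b : R31) : mink a b = mink b a := by
  simp only [mink]; ring

theorem metric_comm (a b : R62) : metric a b = metric b a := by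
  simp only [metric, mink_comm]

theorem metric_add_left (a b c : R62) : metric (a + b) c = metric a c + metric b c := by
  simp only [metric, Prod.fst_add, Prod.snd_add, mink_add_left]; ring

theorem metric_smul_left (r : ℝ) (a b : R62) : metric (r • a) b = r * metric a b := by
  simp only [metric, Prod.smul_fst, Prod.smul_snd, mink_smul_left]; ring

theorem metric_add_right (a b c : R62) : metric a (b + c) = metric a b + metric a c := by
  rw [metric_comm, metric_add_left, metric_comm b, metric_comm c]

theorem metric_smul_right (r : ℝ) (a b : R62) : metric a (r • b) = r * metric a b := by
  rw [metric_comm, metric_smul_left, metric_comm b]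

theorem metric_sub_left (a b c : R62) : metric (a - b) c = metric a c - metric b c := by
  rw [sub_eq_add_neg, ← neg_one_smul ℝ b, metric_add_left, metric_smul_left]; ring

theorem metric_sub_right (a b c : R62) : metric a (b - c) = metric a b - metric a c := by
  rw [metric_comm, metric_sub_left, metric_comm b, metric_comm c]

/-! ### Tangent vectors of `H²` and its Kähler form -/

/-- The vectors orthogonal to a point of `H²` are spacelike. -/
theorem sq_add_sq_le_mul_mink {x v : R31} (hx : x ∈ H2) (hv : mink v x = 0) :
    v 1 ^ 2 + v 2 ^ 2 ≤ x 0 ^ 2 * mink v v := by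
  obtain ⟨h1, -⟩ := hx
  simp only [mink] at *
  have h0 : v 0 * x 0 = v 1 * x 1 + v 2 * x 2 := by linarith
  have h2 : x 0 ^ 2 = 1 + x 1 ^ 2 + x 2 ^ 2 := by linarith
  -- Eliminating `x 0` and `v 0` leaves the Lagrange identity for `(x 1, x 2)` and `(v 1, v 2)`.
  have : x 0 ^ 2 * (-(v 0 * v 0) + v 1 * v 1 + v 2 * v 2)
      = v 1 ^ 2 + v 2 ^ 2 + (x 1 * v 2 - x 2 * v 1) ^ 2 := by
    linear_combination (-(v 0 * x 0) - (v 1 * x 1 + v 2 * x 2)) * h0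
      + (v 1 * v 1 + v 2 * v 2) * h2
  rw [this]
  nlinarith [sq_nonneg (x 1 * v 2 - x 2 * v 1)]

theorem mink_self_nonneg {x v : R31} (hx : x ∈ H2) (hv : mink v x = 0) : 0 ≤ mink v v := by
  have h := sq_add_sq_le_mul_mink hx hv
  have hx0 : 0 < x 0 ^ 2 := pow_pos hx.2 2
  by_contra! hneg
  nlinarith [sq_nonneg (v 1), sq_nonneg (v 2), mul_neg_of_pos_of_neg hx0 hneg]

theorem eq_zero_of_mink_self_eq_zero {x v : R31} (hx : x ∈ H2) (hv : mink v x = 0)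
    (h0 : mink v v = 0) : v = 0 := by
  have h := sq_add_sq_le_mul_mink hx hv
  rw [h0, mul_zero] at h
  have h1 : v 1 = 0 := by nlinarith [sq_nonneg (v 1), sq_nonneg (v 2)]
  have h2 : v 2 = 0 := by nlinarith [sq_nonneg (v 1), sq_nonneg (v 2)]
  have h3 : v 0 = 0 := by
    simp only [mink, h1, h2] at hv
    have : v 0 * x 0 = 0 := by linarith
    exact (mul_eq_zero.1 this).resolve_right hx.2.ne'
  ext i; fin_cases i <;> assumption

theorem metric_self_pos {x v : R62} (hx : x ∈ HH) (h1 : mink v.1 x.1 = 0)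
    (h2 : mink v.2 x.2 = 0) (hv : v ≠ 0) : 0 < metric v v := by
  have n1 := mink_self_nonneg hx.1 h1
  have n2 := mink_self_nonneg hx.2 h2
  rcases (add_nonneg n1 n2).lt_or_eq with h | h
  · exact h
  · refine absurd (Prod.ext ?_ ?_) hv
    · exact eq_zero_of_mink_self_eq_zero hx.1 h1 (by linarith)
    · exact eq_zero_of_mink_self_eq_zero hx.2 h2 (by linarith)

/-- The Kähler form of `H²` squares to the Gram determinant. -/
theorem omegaH2_sq {x v w : R31} (hx : mink x x = -1) (hv : mink v x = 0) (hw : mink w x = 0) :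
    omegaH2 x v w ^ 2 = mink v v * mink w w - mink v w ^ 2 := by
  -- `omegaH2 x v w` is `det(x, v, w)`; its square is minus the Gram determinant of `x, v, w`
  -- because the metric has determinant `-1`.
  have key : omegaH2 x v w ^ 2 = -(mink x x * (mink v v * mink w w - mink v w ^ 2)
      - mink v x * (mink v x * mink w w - mink v w * mink w x)
      + mink w x * (mink v x * mink v w - mink v v * mink w x)) := by
    simp only [omegaH2, JH2, cross, mink, Matrix.cons_val_zero, Matrix.cons_val_one,
      Matrix.cons_val]
    ring
  rw [key, hx, hv, hw]; ring

theorem omegaH2_combo (x a b : R31) (s t s' t' : ℝ) :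
    omegaH2 x (s • a + t • b) (s' • a + t' • b) = (s * t' - t * s') * omegaH2 x a b := by
  simp only [omegaH2, JH2, cross, mink, Matrix.cons_val_zero, Matrix.cons_val_one,
    Matrix.cons_val, Pi.add_apply, Pi.smul_apply, smul_eq_mul]
  ring

theorem metric_J (x v w : R62) :
    metric (J x v) w = omegaH2 x.1 v.1 w.1 - omegaH2 x.2 v.2 w.2 := by
  simp only [metric, J, omegaH2, mink, Pi.neg_apply]; ring

/-! ### Directional derivatives of vector-valued functions on the plane -/

section Derivatives

variable {E : Type*} [NormedAddCommGroup E] [NormedSpace ℝ E]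

/-- The partial derivative `∂ᵢ F` of a vector-valued function. -/
noncomputable def pd (i : Fin 2) (F : Plane → E) (y : Plane) : E := fderiv ℝ F y (basisVec i)

theorem plane_eq (v : Plane) : v = v 0 • basisVec 0 + v 1 • basisVec 1 := by
  ext i; fin_cases i <;> simp [basisVec]

theorem ContDiffOn.pd {s : Set Plane} (hs : IsOpen s) {F : Plane → E}
    (hF : ContDiffOn ℝ ∞ F s) (i : Fin 2) : ContDiffOn ℝ ∞ (LagrangianHH.pd i F) s :=
  (hF.fderiv_of_isOpen hs (m := ∞) (by simp)).clm_apply contDiffOn_const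

theorem pd_comm {s : Set Plane} (hs : IsOpen s) {F : Plane → E}
    (hF : ContDiffOn ℝ ∞ F s) {y : Plane} (hy : y ∈ s) (i j : Fin 2) :
    pd i (pd j F) y = pd j (pd i F) y := by
  have hd : DifferentiableAt ℝ (fderiv ℝ F) y :=
    ((hF.fderiv_of_isOpen hs (m := ∞) (by simp)).differentiableOn (by simp)).differentiableAt
      (hs.mem_nhds hy)
  have key : ∀ i j, pd i (pd j F) y = fderiv ℝ (fderiv ℝ F) y (basisVec i) (basisVec j) := by
    intro i j
    change fderiv ℝ (fun z => fderiv ℝ F z (basisVec j)) y (basisVec i) = _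
    rw [fderiv_clm_apply hd (differentiableAt_const _)]
    simp
  rw [key, key]
  exact (hF.contDiffAt (hs.mem_nhds hy)).isSymmSndFDerivAt
    (by simpa using WithTop.coe_le_coe.2 (le_top : (2 : ℕ∞) ≤ ⊤)) _ _

theorem partialDeriv_mink {u v : Plane → R31} {y : Plane} (hu : DifferentiableAt ℝ u y)
    (hv : DifferentiableAt ℝ v y) (i : Fin 2) :
    partialDeriv i (fun z => mink (u z) (v z)) y
      = mink (pd i u y) (v y) + mink (u y) (pd i v y) := by
  have h := minkL.hasFDerivAt_of_bilinear hu.hasFDerivAt hv.hasFDerivAt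
  simp only [minkL_apply] at h
  rw [partialDeriv, h.fderiv]
  simp [minkL_apply, pd, add_comm]

theorem pd_fst {u : Plane → R62} {y : Plane} (hu : DifferentiableAt ℝ u y) (i : Fin 2) :
    pd i (fun z => (u z).1) y = (pd i u y).1 := by
  rw [pd, pd, fderiv.fst hu]; rfl

theorem pd_snd {u : Plane → R62} {y : Plane} (hu : DifferentiableAt ℝ u y) (i : Fin 2) :
    pd i (fun z => (u z).2) y = (pd i u y).2 := by
  rw [pd, pd, fderiv.snd hu]; rfl

theorem differentiableAt_mink {u v : Plane → R31} {y : Plane} (hu : DifferentiableAt ℝ u y)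
    (hv : DifferentiableAt ℝ v y) : DifferentiableAt ℝ (fun z => mink (u z) (v z)) y :=
  (minkL.hasFDerivAt_of_bilinear hu.hasFDerivAt hv.hasFDerivAt).differentiableAt

theorem differentiableAt_metric {u v : Plane → R62} {y : Plane} (hu : DifferentiableAt ℝ u y)
    (hv : DifferentiableAt ℝ v y) : DifferentiableAt ℝ (fun z => metric (u z) (v z)) y :=
  (differentiableAt_mink hu.fst hv.fst).add (differentiableAt_mink hu.snd hv.snd)

theorem partialDeriv_metric {u v : Plane → R62} {y : Plane} (hu : DifferentiableAt ℝ u y)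
    (hv : DifferentiableAt ℝ v y) (i : Fin 2) :
    partialDeriv i (fun z => metric (u z) (v z)) y
      = metric (pd i u y) (v y) + metric (u y) (pd i v y) := by
  have h1 := partialDeriv_mink hu.fst hv.fst i
  have h2 := partialDeriv_mink hu.snd hv.snd i
  rw [pd_fst hu, pd_fst hv] at h1
  rw [pd_snd hu, pd_snd hv] at h2
  have h3 : partialDeriv i (fun z => metric (u z) (v z)) y
      = partialDeriv i (fun z => mink (u z).1 (v z).1) y
        + partialDeriv i (fun z => mink (u z).2 (v z).2) y := by
    unfold partialDeriv metric
    rw [fderiv_fun_add (differentiableAt_mink hu.fst hv.fst)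
      (differentiableAt_mink hu.snd hv.snd)]
    rfl
  rw [h3, h1, h2]; unfold metric; ring

theorem partialDeriv_congr {u v : Plane → ℝ} {y : Plane} (h : u =ᶠ[nhds y] v) (i : Fin 2) :
    partialDeriv i u y = partialDeriv i v y := by
  rw [partialDeriv, partialDeriv, h.fderiv_eq]

theorem partialDeriv_mul_add_mul {a b c d : Plane → ℝ} {y : Plane}
    (ha : DifferentiableAt ℝ a y) (hb : DifferentiableAt ℝ b y) (hc : DifferentiableAt ℝ c y)
    (hd : DifferentiableAt ℝ d y) (i : Fin 2) :
    partialDeriv i (fun z => a z * b z + c z * d z) y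
      = partialDeriv i a y * b y + a y * partialDeriv i b y
        + (partialDeriv i c y * d y + c y * partialDeriv i d y) := by
  unfold partialDeriv
  rw [fderiv_fun_add (ha.fun_mul hb) (hc.fun_mul hd), fderiv_fun_mul ha hb, fderiv_fun_mul hc hd]
  simp; ring

end Derivatives

/-! ### Christoffel symbols and curvature of an induced metric -/

/-- The matrix of the metric induced by a map `F` from the plane. -/
noncomputable def gramOf (F : Plane → R62) (y : Plane) : Matrix (Fin 2) (Fin 2) ℝ :=
  Matrix.of fun i j => metric (pd i F y) (pd j F y)

theorem gramOf_apply (F : Plane → R62) (y : Plane) (i j : Fin 2) :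
    gramOf F y i j = metric (pd i F y) (pd j F y) := rfl

theorem inv_entries (A : Matrix (Fin 2) (Fin 2) ℝ) :
    A⁻¹ 0 0 = (A.det)⁻¹ * A 1 1 ∧ A⁻¹ 0 1 = -((A.det)⁻¹ * A 0 1) ∧
      A⁻¹ 1 0 = -((A.det)⁻¹ * A 1 0) ∧ A⁻¹ 1 1 = (A.det)⁻¹ * A 0 0 := by
  simp [Matrix.inv_def, Matrix.adjugate_fin_two]

section Smooth

variable {s : Set Plane} {F : Plane → R62} {y : Plane}

theorem differentiableAt_of_contDiffOn {E : Type*} [NormedAddCommGroup E] [NormedSpace ℝ E] {F : Plane → E}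
    (hs : IsOpen s) (hF : ContDiffOn ℝ ∞ F s) (hy : y ∈ s) :
    DifferentiableAt ℝ F y :=
  (hF.differentiableOn (by simp)).differentiableAt (hs.mem_nhds hy)

theorem gramOf_differentiableAt (hs : IsOpen s) (hF : ContDiffOn ℝ ∞ F s) (hy : y ∈ s)
    (i j : Fin 2) : DifferentiableAt ℝ (fun z => gramOf F z i j) y :=
  differentiableAt_metric (differentiableAt_of_contDiffOn hs (ContDiffOn.pd hs hF i) hy)
    (differentiableAt_of_contDiffOn hs (ContDiffOn.pd hs hF j) hy)

theorem det_gramOf_differentiableAt (hs : IsOpen s) (hF : ContDiffOn ℝ ∞ F s) (hy : y ∈ s) :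
    DifferentiableAt ℝ (fun z => (gramOf F z).det) y := by
  simp only [Matrix.det_fin_two]
  have h := gramOf_differentiableAt hs hF hy
  exact ((h 0 0).fun_mul (h 1 1)).fun_sub ((h 0 1).fun_mul (h 1 0))

theorem inv_gramOf_differentiableAt (hs : IsOpen s) (hF : ContDiffOn ℝ ∞ F s) (hy : y ∈ s)
    (hdet : (gramOf F y).det ≠ 0) (k l : Fin 2) :
    DifferentiableAt ℝ (fun z => (gramOf F z)⁻¹ k l) y := by
  have h := gramOf_differentiableAt hs hF hy
  have hd := (det_gramOf_differentiableAt hs hF hy).fun_inv hdet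
  fin_cases k <;> fin_cases l <;> simp only [Fin.zero_eta, Fin.mk_one, Fin.isValue]
  · simp only [(inv_entries _).1]; exact hd.fun_mul (h 1 1)
  · simp only [(inv_entries _).2.1]; exact (hd.fun_mul (h 0 1)).fun_neg
  · simp only [(inv_entries _).2.2.1]; exact (hd.fun_mul (h 1 0)).fun_neg
  · simp only [(inv_entries _).2.2.2]; exact hd.fun_mul (h 0 0)

theorem partialDeriv_gramOf (hs : IsOpen s) (hF : ContDiffOn ℝ ∞ F s) (hy : y ∈ s)
    (i j l : Fin 2) :
    partialDeriv i (fun z => gramOf F z j l) y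
      = metric (pd i (pd j F) y) (pd l F y) + metric (pd j F y) (pd i (pd l F) y) :=
  partialDeriv_metric (differentiableAt_of_contDiffOn hs (ContDiffOn.pd hs hF j) hy)
    (differentiableAt_of_contDiffOn hs (ContDiffOn.pd hs hF l) hy) i

/-- The Christoffel symbols of an induced metric. -/
theorem christoffel_gramOf (hs : IsOpen s) (hF : ContDiffOn ℝ ∞ F s) (hy : y ∈ s)
    (k i j : Fin 2) :
    christoffel (gramOf F) k i j y
      = ∑ l, (gramOf F y)⁻¹ k l * metric (pd i (pd j F) y) (pd l F y) := by
  rw [christoffel, Finset.mul_sum]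
  refine Finset.sum_congr rfl fun l _ => ?_
  -- Of the six product-rule terms four cancel by symmetry of second derivatives; the other two are
  -- equal and absorb the factor `1 / 2`.
  rw [partialDeriv_gramOf hs hF hy, partialDeriv_gramOf hs hF hy, partialDeriv_gramOf hs hF hy,
    pd_comm hs hF hy i l, pd_comm hs hF hy j l, pd_comm hs hF hy j i,
    metric_comm (pd j F y), metric_comm (pd i F y)]
  ring

theorem christoffel_differentiableAt (hs : IsOpen s) (hF : ContDiffOn ℝ ∞ F s) (hy : y ∈ s)
    (hdet : (gramOf F y).det ≠ 0) (k i j : Fin 2) :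
    DifferentiableAt ℝ (christoffel (gramOf F) k i j) y := by
  have h : (fun z => ∑ l, (gramOf F z)⁻¹ k l * metric (pd i (pd j F) z) (pd l F z))
      =ᶠ[nhds y] christoffel (gramOf F) k i j := by
    filter_upwards [hs.mem_nhds hy] with z hz
    exact (christoffel_gramOf hs hF hz k i j).symm
  refine DifferentiableAt.congr_of_eventuallyEq ?_ h.symm
  have hX := ContDiffOn.pd hs hF
  exact DifferentiableAt.fun_sum fun l _ => (inv_gramOf_differentiableAt hs hF hy hdet k l).fun_mul
    (differentiableAt_metric (differentiableAt_of_contDiffOn hs (ContDiffOn.pd hs (hX j) i) hy)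
      (differentiableAt_of_contDiffOn hs (hX l) hy))

/-- Lowering the upper index of the Christoffel symbols. -/
theorem christoffel_lower (hs : IsOpen s) (hF : ContDiffOn ℝ ∞ F s) (hy : y ∈ s)
    (hdet : (gramOf F y).det ≠ 0) (i j k : Fin 2) :
    christoffel (gramOf F) 0 i j y * gramOf F y 0 k
      + christoffel (gramOf F) 1 i j y * gramOf F y 1 k
      = metric (pd i (pd j F) y) (pd k F y) := by
  obtain ⟨h00, h01, h10, h11⟩ := inv_entries (gramOf F y)
  have hsym : gramOf F y 1 0 = gramOf F y 0 1 := metric_comm _ _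
  rw [christoffel_gramOf hs hF hy, christoffel_gramOf hs hF hy]
  simp only [Fin.sum_univ_two, h00, h01, h10, h11]
  have hd := Matrix.det_fin_two (gramOf F y)
  have hm : (gramOf F y).det⁻¹ * (gramOf F y).det = 1 := inv_mul_cancel₀ hdet
  -- Only the second determinant is expanded, so that its inverse stays an atom for
  -- `linear_combination`.
  nth_rewrite 2 [hd] at hm
  rw [hsym] at hm ⊢
  fin_cases k <;> simp only [Fin.zero_eta, Fin.mk_one, Fin.isValue, hsym]
  · linear_combination metric (pd i (pd j F) y) (pd 0 F y) * hm
  · linear_combination metric (pd i (pd j F) y) (pd 1 F y) * hm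

/-- The Gauss equation for the flat ambient space, in coordinates. -/
theorem riemannCoeff_gramOf (hs : IsOpen s) (hF : ContDiffOn ℝ ∞ F s) (hy : y ∈ s)
    (hdet : (gramOf F y).det ≠ 0) :
    ∑ l, riemannCoeff (gramOf F) l 0 1 1 y * gramOf F y l 0
      = metric (pd 1 (pd 1 F) y) (pd 0 (pd 0 F) y) - metric (pd 0 (pd 1 F) y) (pd 0 (pd 1 F) y)
        - ∑ i, ∑ j, (gramOf F y)⁻¹ i j * (metric (pd 0 (pd 0 F) y) (pd i F y)
            * metric (pd 1 (pd 1 F) y) (pd j F y)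
          - metric (pd 0 (pd 1 F) y) (pd i F y) * metric (pd 0 (pd 1 F) y) (pd j F y)) := by
  have hX := ContDiffOn.pd hs hF
  -- The lowering formula will be differentiated, so it is needed on a whole neighbourhood of `y`.
  have hne : ∀ᶠ z in nhds y, (gramOf F z).det ≠ 0 :=
    (det_gramOf_differentiableAt hs hF hy).continuousAt.eventually_ne hdet
  -- Differentiating the lowered symbols gives `∂Γ` contracted with `g`, without differentiating the
  -- inverse matrix.
  have hder : ∀ a j k : Fin 2,
      partialDeriv a (christoffel (gramOf F) 0 j k) y * gramOf F y 0 0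
        + partialDeriv a (christoffel (gramOf F) 1 j k) y * gramOf F y 1 0
      = metric (pd a (pd j (pd k F)) y) (pd 0 F y)
        + metric (pd j (pd k F) y) (pd a (pd 0 F) y)
        - (christoffel (gramOf F) 0 j k y * partialDeriv a (fun z => gramOf F z 0 0) y
          + christoffel (gramOf F) 1 j k y * partialDeriv a (fun z => gramOf F z 1 0) y) := by
    intro a j k
    have h1 : (fun z => christoffel (gramOf F) 0 j k z * gramOf F z 0 0
        + christoffel (gramOf F) 1 j k z * gramOf F z 1 0)
        =ᶠ[nhds y] fun z => metric (pd j (pd k F) z) (pd 0 F z) := by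
      filter_upwards [hs.mem_nhds hy, hne] with z hz hz'
      exact christoffel_lower hs hF hz hz' j k 0
    have h2 := partialDeriv_congr h1 a
    have hc := christoffel_differentiableAt hs hF hy hdet
    have hg := gramOf_differentiableAt hs hF hy
    rw [partialDeriv_mul_add_mul (hc 0 j k) (hg 0 0) (hc 1 j k) (hg 1 0),
      partialDeriv_metric (differentiableAt_of_contDiffOn hs (ContDiffOn.pd hs (hX k) j) hy)
        (differentiableAt_of_contDiffOn hs (hX 0) hy)] at h2
    linarith
  have h0 := hder 0 1 1
  have h1 := hder 1 0 1
  -- Puts the third derivative in the form it has in `h0`, so that it cancels in `h0 - h1`.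
  rw [pd_comm hs (hX 1) hy 1 0, pd_comm hs hF hy 1 0] at h1
  simp only [partialDeriv_gramOf hs hF hy] at h0 h1
  rw [pd_comm hs hF hy 1 0] at h1
  have hl := christoffel_lower hs hF hy hdet
  have l0 := hl 0 0 0
  have l1 := hl 0 1 0
  have l2 := hl 1 1 0
  have e0 := christoffel_gramOf hs hF hy 0 1 1
  have e1 := christoffel_gramOf hs hF hy 1 1 1
  have e2 := christoffel_gramOf hs hF hy 0 0 1
  have e3 := christoffel_gramOf hs hF hy 1 0 1
  have l3 := hl 1 0 0
  rw [pd_comm hs hF hy 1 0] at l3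
  simp only [riemannCoeff, Fin.sum_univ_two] at *
  simp only [metric_comm (pd 0 F y), metric_comm (pd 1 F y)] at *
  -- The `l`'s lower the `ΓΓ` terms, which cancel half of each `Γ ∂g`; the `e`'s expand the symbols
  -- in the other half.
  linear_combination h0 - h1 + christoffel (gramOf F) 0 1 1 y * l0
    + christoffel (gramOf F) 1 1 1 y * l1 - christoffel (gramOf F) 0 0 1 y * l3
    - christoffel (gramOf F) 1 0 1 y * l2
    - metric (pd 0 (pd 0 F) y) (pd 0 F y) * e0 - metric (pd 0 (pd 0 F) y) (pd 1 F y) * e1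
    + metric (pd 0 (pd 1 F) y) (pd 0 F y) * e2 + metric (pd 0 (pd 1 F) y) (pd 1 F y) * e3

end Smooth

/-! ### Linear algebra of the second fundamental form -/

/-- The normals `(x₁, 0)` and `(0, x₂)` are orthogonal of square `-1`, so removing the components
along them adds the products of coefficients. These products yield the ambient curvature term. -/
theorem metric_projHH_projHH {x : R62} (hx : x ∈ HH) (v w : R62) :
    metric (projHH x v) (projHH x w)
      = metric v w + mink v.1 x.1 * mink w.1 x.1 + mink v.2 x.2 * mink w.2 x.2 := by
  have h1 := hx.1.1
  have h2 := hx.2.1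
  simp only [metric, projHH, mink, Pi.add_apply, Pi.smul_apply, smul_eq_mul] at *
  linear_combination
    ((-(v.1 0 * x.1 0) + v.1 1 * x.1 1 + v.1 2 * x.1 2)
      * (-(w.1 0 * x.1 0) + w.1 1 * x.1 1 + w.1 2 * x.1 2)) * h1
    + ((-(v.2 0 * x.2 0) + v.2 1 * x.2 1 + v.2 2 * x.2 2)
      * (-(w.2 0 * x.2 0) + w.2 1 * x.2 1 + w.2 2 * x.2 2)) * h2

theorem metric_projHH_left {x v w : R62} (h1 : mink w.1 x.1 = 0) (h2 : mink w.2 x.2 = 0) :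
    metric (projHH x v) w = metric v w := by
  simp only [metric, projHH, mink_add_left, mink_smul_left, mink_comm x.1, mink_comm x.2, h1, h2]
  ring

/-- The inner product of the components of two vectors normal to a nondegenerate plane. -/
theorem metric_normal_normal (X : Fin 2 → R62) {G : Matrix (Fin 2) (Fin 2) ℝ}
    (hG : ∀ i j, G i j = metric (X i) (X j)) (hdet : G.det ≠ 0) (v w : R62) :
    metric (v - ∑ i, ∑ j, (G⁻¹ i j * metric v (X j)) • X i)
        (w - ∑ i, ∑ j, (G⁻¹ i j * metric w (X j)) • X i)
      = metric v w - ∑ i, ∑ j, G⁻¹ i j * (metric v (X i) * metric w (X j)) := by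
  obtain ⟨h00, h01, h10, h11⟩ := inv_entries G
  have hm : G.det⁻¹ * G.det = 1 := inv_mul_cancel₀ hdet
  nth_rewrite 2 [Matrix.det_fin_two] at hm
  simp only [Fin.sum_univ_two, h00, h01, h10, h11, metric_sub_left, metric_sub_right,
    metric_add_left, metric_add_right, metric_smul_left, metric_smul_right,
    hG, metric_comm (X 1) (X 0), metric_comm (X 0) w, metric_comm (X 1) w] at hm ⊢
  set d := G.det⁻¹
  linear_combination (d * (metric (X 1) (X 1) * metric v (X 0) * metric w (X 0)
    - metric (X 0) (X 1) * metric v (X 0) * metric w (X 1)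
    - metric (X 0) (X 1) * metric v (X 1) * metric w (X 0)
    + metric (X 0) (X 0) * metric v (X 1) * metric w (X 1))) * hm

/-- The combination `2‖H‖² - ½‖h‖²` for a symmetric two-tensor `h` on a plane. -/
theorem trace_sub_norm (B : Fin 2 → Fin 2 → R62) (hB : B 1 0 = B 0 1)
    {G : Matrix (Fin 2) (Fin 2) ℝ} (hG : G 1 0 = G 0 1) (hdet : G.det ≠ 0) :
    2 * normSq ((1 / 2 : ℝ) • ∑ i, ∑ j, G⁻¹ i j • B i j)
      - (1 / 2) * ∑ i, ∑ j, ∑ k, ∑ l, G⁻¹ i k * G⁻¹ j l * metric (B i j) (B k l)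
      = (G.det)⁻¹ * (metric (B 1 1) (B 0 0) - metric (B 0 1) (B 0 1)) := by
  obtain ⟨h00, h01, h10, h11⟩ := inv_entries G
  have hm : G.det⁻¹ * G.det = 1 := inv_mul_cancel₀ hdet
  nth_rewrite 2 [Matrix.det_fin_two] at hm
  simp only [normSq, Fin.sum_univ_two, h00, h01, h10, h11, metric_add_left, metric_add_right,
    metric_smul_left, metric_smul_right, hB, hG, metric_comm (B 1 1), metric_comm (B 0 1) (B 0 0)]
      at hm ⊢
  simp only [metric_comm (B 0 1) (B 1 1)]
  set d := G.det⁻¹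
  linear_combination (d * (metric (B 0 0) (B 1 1) - metric (B 0 1) (B 0 1))) * hm

/-! ### Maps from the plane into `H² × H²` -/

section IntoHH

variable {s : Set Plane} {F : Plane → R62} {y : Plane}

theorem mink_pd_self {u : Plane → R31} (hs : IsOpen s) (hu : ContDiffOn ℝ ∞ u s)
    (hH : ∀ z ∈ s, u z ∈ H2) (hy : y ∈ s) (i : Fin 2) : mink (pd i u y) (u y) = 0 := by
  have hd := differentiableAt_of_contDiffOn hs hu hy
  have h1 : (fun z => mink (u z) (u z)) =ᶠ[nhds y] fun _ => (-1 : ℝ) := by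
    filter_upwards [hs.mem_nhds hy] with z hz using (hH z hz).1
  have h2 := partialDeriv_congr h1 i
  rw [partialDeriv_mink hd hd, mink_comm (u y)] at h2
  have : partialDeriv i (fun _ => (-1 : ℝ)) y = 0 := by simp [partialDeriv]
  linarith

/-- Differentiate `⟨∂ⱼu, u⟩ = 0`. This is the second fundamental form of `H²` in `ℝ³₁`, through
which the curvature `-1` enters. -/
theorem mink_pd_pd_self {u : Plane → R31} (hs : IsOpen s) (hu : ContDiffOn ℝ ∞ u s)
    (hH : ∀ z ∈ s, u z ∈ H2) (hy : y ∈ s) (i j : Fin 2) :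
    mink (pd i (pd j u) y) (u y) = -mink (pd i u y) (pd j u y) := by
  have hd := differentiableAt_of_contDiffOn hs hu hy
  have hd' := differentiableAt_of_contDiffOn hs (ContDiffOn.pd hs hu j) hy
  have h1 : (fun z => mink (pd j u z) (u z)) =ᶠ[nhds y] fun _ => (0 : ℝ) := by
    filter_upwards [hs.mem_nhds hy] with z hz using mink_pd_self hs hu hH hz j
  have h2 := partialDeriv_congr h1 i
  rw [partialDeriv_mink hd' hd, mink_comm (pd j u y)] at h2
  have : partialDeriv i (fun _ => (0 : ℝ)) y = 0 := by simp [partialDeriv]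
  linarith

theorem pd_pd_fst (hs : IsOpen s) (hF : ContDiffOn ℝ ∞ F s) (hy : y ∈ s) (i j : Fin 2) :
    pd i (pd j fun z => (F z).1) y = (pd i (pd j F) y).1 := by
  have h : (pd j fun z => (F z).1) =ᶠ[nhds y] fun z => (pd j F z).1 := by
    filter_upwards [hs.mem_nhds hy] with z hz using pd_fst (differentiableAt_of_contDiffOn hs hF hz) j
  rw [pd, h.fderiv_eq]
  exact pd_fst (differentiableAt_of_contDiffOn hs (ContDiffOn.pd hs hF j) hy) i

theorem pd_pd_snd (hs : IsOpen s) (hF : ContDiffOn ℝ ∞ F s) (hy : y ∈ s) (i j : Fin 2) :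
    pd i (pd j fun z => (F z).2) y = (pd i (pd j F) y).2 := by
  have h : (pd j fun z => (F z).2) =ᶠ[nhds y] fun z => (pd j F z).2 := by
    filter_upwards [hs.mem_nhds hy] with z hz using pd_snd (differentiableAt_of_contDiffOn hs hF hz) j
  rw [pd, h.fderiv_eq]
  exact pd_snd (differentiableAt_of_contDiffOn hs (ContDiffOn.pd hs hF j) hy) i

theorem mink_pd_tangent (hs : IsOpen s) (hF : ContDiffOn ℝ ∞ F s) (hH : ∀ z ∈ s, F z ∈ HH)
    (hy : y ∈ s) (i : Fin 2) :
    mink (pd i F y).1 (F y).1 = 0 ∧ mink (pd i F y).2 (F y).2 = 0 := by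
  have hd := differentiableAt_of_contDiffOn hs hF hy
  have h1 := mink_pd_self hs (contDiff_fst.comp_contDiffOn hF) (fun z hz => (hH z hz).1) hy i
  have h2 := mink_pd_self hs (contDiff_snd.comp_contDiffOn hF) (fun z hz => (hH z hz).2) hy i
  exact ⟨by rw [← pd_fst hd]; exact h1, by rw [← pd_snd hd]; exact h2⟩

theorem mink_pd_pd_tangent (hs : IsOpen s) (hF : ContDiffOn ℝ ∞ F s) (hH : ∀ z ∈ s, F z ∈ HH)
    (hy : y ∈ s) (i j : Fin 2) :
    mink (pd i (pd j F) y).1 (F y).1 = -mink (pd i F y).1 (pd j F y).1 ∧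
      mink (pd i (pd j F) y).2 (F y).2 = -mink (pd i F y).2 (pd j F y).2 := by
  have hd := differentiableAt_of_contDiffOn hs hF hy
  have h1 := mink_pd_pd_self hs (contDiff_fst.comp_contDiffOn hF) (fun z hz => (hH z hz).1) hy i j
  have h2 := mink_pd_pd_self hs (contDiff_snd.comp_contDiffOn hF) (fun z hz => (hH z hz).2) hy i j
  rw [← pd_pd_fst hs hF hy, ← pd_pd_snd hs hF hy, ← pd_fst hd, ← pd_fst hd, ← pd_snd hd,
    ← pd_snd hd]
  exact ⟨h1, h2⟩

/-- The Gauss equation for a surface in `H² × H²`, in coordinates. -/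
theorem gauss_equation_coord (hs : IsOpen s) (hF : ContDiffOn ℝ ∞ F s) (hH : ∀ z ∈ s, F z ∈ HH)
    (hy : y ∈ s) (hdet : (gramOf F y).det ≠ 0) (B : Fin 2 → Fin 2 → R62)
    (hB : ∀ i j, B i j = projHH (F y) (pd i (pd j F) y)
      - ∑ a, ∑ b, ((gramOf F y)⁻¹ a b * metric (projHH (F y) (pd i (pd j F) y)) (pd b F y))
        • pd a F y) :
    gaussCurvatureCoord (gramOf F) y
      = (gramOf F y).det⁻¹ * (metric (B 1 1) (B 0 0) - metric (B 0 1) (B 0 1)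
        - omegaH2 (F y).1 (pd 0 F y).1 (pd 1 F y).1 ^ 2
        - omegaH2 (F y).2 (pd 0 F y).2 (pd 1 F y).2 ^ 2) := by
  have ht := mink_pd_tangent hs hF hH hy
  have hn := mink_pd_pd_tangent hs hF hH hy
  have hBB : ∀ i j k l, metric (B i j) (B k l) = metric (pd i (pd j F) y) (pd k (pd l F) y)
      + mink (pd i F y).1 (pd j F y).1 * mink (pd k F y).1 (pd l F y).1
      + mink (pd i F y).2 (pd j F y).2 * mink (pd k F y).2 (pd l F y).2
      - ∑ a, ∑ b, (gramOf F y)⁻¹ a b * (metric (pd i (pd j F) y) (pd a F y)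
        * metric (pd k (pd l F) y) (pd b F y)) := by
    intro i j k l
    rw [hB, hB, metric_normal_normal (fun a => pd a F y) (gramOf_apply F y) hdet,
      metric_projHH_projHH (hH y hy)]
    -- Products with the tangent vectors `∂ₐF` do not see the projection, so the tangential terms
    -- are those of the flat Gauss equation.
    simp only [metric_projHH_left (ht _).1 (ht _).2, (hn _ _).1, (hn _ _).2]
    ring
  rw [gaussCurvatureCoord, riemannCoeff_gramOf hs hF hy hdet, div_eq_inv_mul, hBB, hBB,
    omegaH2_sq (hH y hy).1.1 (ht 0).1 (ht 1).1, omegaH2_sq (hH y hy).2.1 (ht 0).2 (ht 1).2]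
  obtain ⟨h00, h01, h10, h11⟩ := inv_entries (gramOf F y)
  have hsym : gramOf F y 1 0 = gramOf F y 0 1 := metric_comm _ _
  simp only [Fin.sum_univ_two, h00, h01, h10, h11, hsym]
  ring

end IntoHH

/-! ### Surfaces -/

section Surface

variable {M : Type*} [TopologicalSpace M] [ChartedSpace Plane M]

theorem mfderiv_eq_fderiv {E : Type*} [NormedAddCommGroup E] [NormedSpace ℝ E] {f : M → E} {p : M}
    (hf : MDifferentiableAt (𝓡 2) 𝓘(ℝ, E) f p) :
    mfderiv (𝓡 2) 𝓘(ℝ, E) f p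
      = fderiv ℝ (fun y : Plane => f ((extChartAt (𝓡 2) p).symm y)) (extChartAt (𝓡 2) p p) := by
  rw [hf.mfderiv]
  simp [writtenInExtChartAt, Function.comp_def]
  rfl

variable {Φ : M → R62}

theorem IsLagrangianImmersion.mdifferentiableAt (hΦ : IsLagrangianImmersion Φ) (p : M) :
    MDifferentiableAt (𝓡 2) 𝓘(ℝ, R62) Φ p :=
  hΦ.smooth.contMDiffAt.mdifferentiableAt (by simp)

theorem IsLagrangianImmersion.push_eq (hΦ : IsLagrangianImmersion Φ) (p : M)
    (v : TangentSpace (𝓡 2) p) :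
    push Φ p v = fderiv ℝ (localRep Φ p) (extChartAt (𝓡 2) p p) (v : Plane) := by
  rw [push, mfderiv_eq_fderiv (hΦ.mdifferentiableAt p)]; rfl

theorem IsLagrangianImmersion.push_tangentBasis (hΦ : IsLagrangianImmersion Φ) (p : M)
    (i : Fin 2) :
    push Φ p (tangentBasis p i) = pd i (localRep Φ p) (extChartAt (𝓡 2) p p) :=
  hΦ.push_eq p _

theorem IsLagrangianImmersion.localRep_contDiffOn [IsManifold (𝓡 2) ∞ M]
    (hΦ : IsLagrangianImmersion Φ) (p : M) :
    ContDiffOn ℝ ∞ (localRep Φ p) (extChartAt (𝓡 2) p).target := by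
  rw [← contMDiffOn_iff_contDiffOn]
  exact hΦ.smooth.comp_contMDiffOn (contMDiffOn_extChartAt_symm p)

theorem localRep_base (Φ : M → R62) (p : M) :
    localRep Φ p (extChartAt (𝓡 2) p p) = Φ p := by
  simp [localRep]

theorem IsLagrangianImmersion.gram_eq (hΦ : IsLagrangianImmersion Φ) (p : M) :
    gram Φ p = gramOf (localRep Φ p) (extChartAt (𝓡 2) p p) := by
  ext i j
  simp only [gram, inducedMetric, hΦ.push_tangentBasis, Matrix.of_apply, gramOf]

/-- A vector of the plane as a tangent vector at `p`, through the preferred chart. -/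
def toTangent (p : M) (v : Plane) : TangentSpace (𝓡 2) p := v

theorem IsLagrangianImmersion.push_combo (hΦ : IsLagrangianImmersion Φ) (p : M) (v : Plane) :
    push Φ p (toTangent p v)
      = v 0 • push Φ p (tangentBasis p 0) + v 1 • push Φ p (tangentBasis p 1) := by
  rw [hΦ.push_eq, hΦ.push_eq, hΦ.push_eq]
  have h := congrArg (fderiv ℝ (localRep Φ p) (extChartAt (𝓡 2) p p)) (plane_eq v)
  rw [map_add, map_smul, map_smul] at h
  exact h

end Surface

/-! ### Two-forms and the induced metric in the coordinate basis -/

theorem alternating_combo {V : Type*} [AddCommGroup V] [Module ℝ V] (A : V [⋀^Fin 2]→ₗ[ℝ] ℝ)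
    (a b : V) (s t s' t' : ℝ) :
    A ![s • a + t • b, s' • a + t' • b] = (s * t' - t * s') * A ![a, b] := by
  have hswap : ∀ x y : V, A ![x, y] = -A ![y, x] := by
    intro x y
    have h := A.map_swap ![y, x] (i := 0) (j := 1) (by decide)
    rw [← h]
    congr 1
    ext i; fin_cases i <;> simp
  have hself : ∀ x : V, A ![x, x] = 0 := fun x => by linarith [hswap x x]
  have hl : ∀ (x y z : V) (s t : ℝ), A ![s • x + t • y, z] = s * A ![x, z] + t * A ![y, z] := by
    intro x y z s t
    rw [A.map_vecCons_add, A.map_vecCons_smul, A.map_vecCons_smul]; rfl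
  rw [hl, hswap a, hswap b, hl, hl, hself, hself, hswap b a]; ring

section Surface

variable {M : Type*} [TopologicalSpace M] [ChartedSpace Plane M] {Φ : M → R62}

theorem pullbackOmega_fst (hΦ : IsLagrangianImmersion Φ) (p : M) (v w : TangentSpace (𝓡 2) p) :
    pullbackOmega (fun q => (Φ q).1) p v w
      = omegaH2 (Φ p).1 (push Φ p v).1 (push Φ p w).1 := by
  have h := ((ContinuousLinearMap.fst ℝ R31 R31).hasMFDerivAt (x := Φ p)).comp p
    (hΦ.mdifferentiableAt p).hasMFDerivAt
  have h' : mfderiv (𝓡 2) 𝓘(ℝ, R31) (fun q => (Φ q).1) p = _ := h.mfderiv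
  rw [pullbackOmega, h']; rfl

theorem pullbackOmega_snd (hΦ : IsLagrangianImmersion Φ) (p : M) (v w : TangentSpace (𝓡 2) p) :
    pullbackOmega (fun q => (Φ q).2) p v w
      = omegaH2 (Φ p).2 (push Φ p v).2 (push Φ p w).2 := by
  have h := ((ContinuousLinearMap.snd ℝ R31 R31).hasMFDerivAt (x := Φ p)).comp p
    (hΦ.mdifferentiableAt p).hasMFDerivAt
  have h' : mfderiv (𝓡 2) 𝓘(ℝ, R31) (fun q => (Φ q).2) p = _ := h.mfderiv
  rw [pullbackOmega, h']; rfl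

/-- The minus sign in the second factor of `J` makes its Kähler form the difference of the two forms
`ω`, and this vanishes on the tangent planes. -/
theorem pullbackOmega_snd_eq_fst (hΦ : IsLagrangianImmersion Φ) (p : M)
    (v w : TangentSpace (𝓡 2) p) :
    pullbackOmega (fun q => (Φ q).2) p v w = pullbackOmega (fun q => (Φ q).1) p v w := by
  have h := hΦ.lagrangian p v w
  rw [metric_J] at h
  rw [pullbackOmega_fst hΦ, pullbackOmega_snd hΦ]
  linarith

theorem pullbackOmega_fst_combo (hΦ : IsLagrangianImmersion Φ) (p : M) (v w : Plane) :
    pullbackOmega (fun q => (Φ q).1) p (toTangent p v) (toTangent p w)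
      = (v 0 * w 1 - v 1 * w 0)
        * pullbackOmega (fun q => (Φ q).1) p (tangentBasis p 0) (tangentBasis p 1) := by
  rw [pullbackOmega_fst hΦ, pullbackOmega_fst hΦ, hΦ.push_combo p v, hΦ.push_combo p w]
  exact omegaH2_combo _ _ _ _ _ _ _

theorem vol_combo (p : M) (A : TangentSpace (𝓡 2) p [⋀^Fin 2]→ₗ[ℝ] ℝ) (v w : Plane) :
    A ![toTangent p v, toTangent p w]
      = (v 0 * w 1 - v 1 * w 0) * A ![tangentBasis p 0, tangentBasis p 1] := by
  have h := alternating_combo A (tangentBasis p 0) (tangentBasis p 1) (v 0) (v 1) (w 0) (w 1)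
  have hv : ∀ u : Plane, toTangent p u = u 0 • tangentBasis p 0 + u 1 • tangentBasis p 1 := plane_eq
  rw [hv v, hv w]
  exact h

theorem inducedMetric_combo (hΦ : IsLagrangianImmersion Φ) (p : M) (v w : Plane) :
    inducedMetric Φ p (toTangent p v) (toTangent p w)
      = v 0 * w 0 * gram Φ p 0 0 + (v 0 * w 1 + v 1 * w 0) * gram Φ p 0 1
      + v 1 * w 1 * gram Φ p 1 1 := by
  rw [inducedMetric, hΦ.push_combo p v, hΦ.push_combo p w]
  simp only [gram, inducedMetric, Matrix.of_apply, metric_add_left, metric_add_right,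
    metric_smul_left, metric_smul_right,
    metric_comm (push Φ p (tangentBasis p 1)) (push Φ p (tangentBasis p 0))]
  ring

theorem gram_symm (Φ : M → R62) (p : M) : gram Φ p 1 0 = gram Φ p 0 1 := metric_comm _ _

variable [IsManifold (𝓡 2) ∞ M]

/-- `metric` is indefinite on `ℝ⁶₂`; positivity holds because `Φ_* v` is nonzero and tangent to `H²
× H²`. -/
theorem inducedMetric_pos (hΦ : IsLagrangianImmersion Φ) (p : M) {v : Plane} (hv : v ≠ 0) :
    0 < inducedMetric Φ p (toTangent p v) (toTangent p v) := by
  have ht := mink_pd_tangent (isOpen_extChartAt_target (I := 𝓡 2) p) (hΦ.localRep_contDiffOn p)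
    (fun z _ => hΦ.mem_HH _) (mem_extChartAt_target p)
  simp only [localRep_base] at ht
  have h0 := ht 0
  have h1 := ht 1
  rw [← hΦ.push_tangentBasis] at h0 h1
  have hne : push Φ p (toTangent p v) ≠ 0 := fun h => hv (hΦ.immersion p (h.trans (map_zero _).symm))
  refine metric_self_pos (hΦ.mem_HH p) ?_ ?_ hne <;> rw [hΦ.push_combo p v]
  · simp only [Prod.fst_add, Prod.smul_fst, mink_add_left, mink_smul_left, h0.1, h1.1]; ring
  · simp only [Prod.snd_add, Prod.smul_snd, mink_add_left, mink_smul_left, h0.2, h1.2]; ring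

theorem gram_zero_zero_pos (hΦ : IsLagrangianImmersion Φ) (p : M) : 0 < gram Φ p 0 0 := by
  refine inducedMetric_pos hΦ p (v := basisVec 0) fun h => ?_
  simpa [basisVec] using congrArg (fun u : Plane => u 0) h

theorem det_gram_pos (hΦ : IsLagrangianImmersion Φ) (p : M) : 0 < (gram Φ p).det := by
  have hg := gram_zero_zero_pos hΦ p
  -- This vector is orthogonal to `∂₀` and has squared length `g₀₀ · det g`.
  have h := inducedMetric_pos hΦ p (v := !₂[-gram Φ p 0 1, gram Φ p 0 0]) fun h => by
    have := congrArg (fun u : Plane => u 1) h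
    simp at this
    exact hg.ne' this
  rw [inducedMetric_combo hΦ] at h
  simp at h
  rw [Matrix.det_fin_two, gram_symm]
  refine pos_of_mul_pos_right (a := gram Φ p 0 0) ?_ hg.le
  nlinarith

theorem vol_sq (hΦ : IsLagrangianImmersion Φ) {U : Set M}
    {vol : ∀ p : M, TangentSpace (𝓡 2) p [⋀^Fin 2]→ₗ[ℝ] ℝ} (hω : IsVolumeFormOn Φ vol U)
    {p : M} (hp : p ∈ U) :
    vol p ![tangentBasis p 0, tangentBasis p 1] ^ 2 = (gram Φ p).det := by
  have hg := gram_zero_zero_pos hΦ p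
  have hD := det_gram_pos hΦ p
  have hDe := Matrix.det_fin_two (gram Φ p)
  rw [gram_symm] at hDe
  -- Gram–Schmidt: `r` normalises `∂₀`, and `q` normalises the orthogonal vector `(-g₀₁, g₀₀)`. On
  -- this basis `vol` equals `r q g₀₀ vol(∂₀, ∂₁)`.
  obtain ⟨r, hr⟩ : ∃ r : ℝ, r ^ 2 * gram Φ p 0 0 = 1 :=
    ⟨(√(gram Φ p 0 0))⁻¹, by rw [inv_pow, Real.sq_sqrt hg.le, inv_mul_cancel₀ hg.ne']⟩
  have hgD := mul_pos hg hD
  obtain ⟨q, hq⟩ : ∃ q : ℝ, q ^ 2 * (gram Φ p 0 0 * (gram Φ p).det) = 1 :=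
    ⟨(√(gram Φ p 0 0 * (gram Φ p).det))⁻¹, by
      rw [inv_pow, Real.sq_sqrt hgD.le, inv_mul_cancel₀ hgD.ne']⟩
  have h := hω p hp (toTangent p !₂[r, 0]) (toTangent p !₂[-q * gram Φ p 0 1, q * gram Φ p 0 0])
    (by rw [inducedMetric_combo hΦ]; simp; linarith)
    (by
      rw [inducedMetric_combo hΦ]; simp
      rw [hDe] at hq
      linear_combination hq)
    (by rw [inducedMetric_combo hΦ]; simp; ring)
  rw [vol_combo] at h
  have h2 := sq_abs (((!₂[r, 0] : Plane) 0 * (!₂[-q * gram Φ p 0 1, q * gram Φ p 0 0] : Plane) 1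
    - (!₂[r, 0] : Plane) 1 * (!₂[-q * gram Φ p 0 1, q * gram Φ p 0 0] : Plane) 0)
      * vol p ![tangentBasis p 0, tangentBasis p 1])
  rw [h] at h2
  simp at h2
  set V := vol p ![tangentBasis p 0, tangentBasis p 1]
  linear_combination -(gram Φ p).det * h2 - V ^ 2 * q ^ 2 * gram Φ p 0 0 * (gram Φ p).det * hr
    - V ^ 2 * hq

/-- The Gauss equation for Lagrangian surfaces in `H² × H²`. -/
theorem gauss_equation (hΦ : IsLagrangianImmersion Φ) (p : M) :
    gaussCurvature Φ p = 2 * normSq (meanCurvature Φ p) - (1 / 2) * secondFundFormNormSq Φ p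
      - 2 * ((gram Φ p).det⁻¹
        * pullbackOmega (fun q => (Φ q).1) p (tangentBasis p 0) (tangentBasis p 1) ^ 2) := by
  have hopen := isOpen_extChartAt_target (I := 𝓡 2) p
  have hF := hΦ.localRep_contDiffOn p
  have hy := mem_extChartAt_target (I := 𝓡 2) p
  have hdet := (det_gram_pos hΦ p).ne'
  have key := gauss_equation_coord hopen hF (fun z _ => hΦ.mem_HH _) hy
    (by rwa [← hΦ.gram_eq])
    (fun i j => secondFundForm Φ p (tangentBasis p i) (tangentBasis p j)) (fun i j => by
      simp only [secondFundForm, tangentPart, ← hΦ.gram_eq, hΦ.push_tangentBasis, localRep_base]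
      rfl)
  -- Symmetry of `h` is that of the second derivatives, since both projections depend only on `p`.
  have hsymm : secondFundForm Φ p (tangentBasis p 1) (tangentBasis p 0)
      = secondFundForm Φ p (tangentBasis p 0) (tangentBasis p 1) := by
    have : ambientDeriv Φ p (tangentBasis p 1) (tangentBasis p 0)
        = ambientDeriv Φ p (tangentBasis p 0) (tangentBasis p 1) :=
      congrArg (projHH (Φ p)) (pd_comm hopen hF hy 1 0)
    rw [secondFundForm, secondFundForm, this]
  have htr := trace_sub_norm
    (fun i j => secondFundForm Φ p (tangentBasis p i) (tangentBasis p j)) hsymm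
    (gram_symm Φ p) hdet
  have h2 := pullbackOmega_snd_eq_fst hΦ p (tangentBasis p 0) (tangentBasis p 1)
  have h1 := pullbackOmega_fst hΦ p (tangentBasis p 0) (tangentBasis p 1)
  rw [pullbackOmega_snd hΦ] at h2
  rw [localRep_base, ← hΦ.gram_eq, ← hΦ.push_tangentBasis, ← hΦ.push_tangentBasis, h2, ← h1]
    at key
  have hK : gaussCurvature Φ p
      = gaussCurvatureCoord (gramOf (localRep Φ p)) (extChartAt (𝓡 2) p p) := rfl
  rw [hK, key, meanCurvature, secondFundFormNormSq, htr]
  ring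

end Surface

end LagrangianHH

theorem mainTheorem6 {M : Type*} [TopologicalSpace M] [ChartedSpace Plane M]
    [IsManifold (𝓡 2) ∞ M] (Φ : M → R62) (hΦ : IsLagrangianImmersion Φ) (U : Set M)
    (vol : ∀ p : M, TangentSpace (𝓡 2) p [⋀^Fin 2]→ₗ[ℝ] ℝ) (hω : IsVolumeFormOn Φ vol U) :
    (∃ Γ : M → ℝ, IsGammaOn Φ vol U Γ) ∧
    ∀ Γ : M → ℝ, IsGammaOn Φ vol U Γ → ∀ p ∈ U,
      gaussCurvature Φ p
        = 2 * normSq (meanCurvature Φ p) - (1 / 2) * secondFundFormNormSq Φ p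
          - 2 * (Γ p) ^ 2 := by
  constructor
  -- Two-forms on a plane are proportional, so `Γ` is the ratio on the coordinate basis; `vol` is
  -- nonzero there by `vol_sq`.
  · refine ⟨fun p => pullbackOmega (fun q => (Φ q).1) p (tangentBasis p 0) (tangentBasis p 1)
      / vol p ![tangentBasis p 0, tangentBasis p 1], fun p hp v w => ?_⟩
    have hV : vol p ![tangentBasis p 0, tangentBasis p 1] ≠ 0 := fun h => by
      have h1 := vol_sq hΦ hω hp
      rw [h] at h1
      have h2 := det_gram_pos hΦ p
      norm_num at h1
      exact h2.ne h1
    have h1 : ∀ v w : TangentSpace (𝓡 2) p, _ := pullbackOmega_fst_combo hΦ p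
    have h2 : ∀ v w : TangentSpace (𝓡 2) p, _ := vol_combo p (vol p)
    simp only [toTangent] at h1 h2
    rw [pullbackOmega_snd_eq_fst hΦ, and_self, h1 v w, h2 v w]
    field_simp
  · intro Γ hΓ p hp
    -- `hΓ` is evaluated on the coordinate basis, where `vol² = det g` cancels the inverse
    -- determinant.
    rw [gauss_equation hΦ, (hΓ p hp _ _).1, mul_pow, vol_sq hΦ hω hp]
    have := (det_gram_pos hΦ p).ne'
    field_simp
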